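/- Let $A$ be a finite set of letters. A word $w=a_1\cdots a_m$ ($m\ge 0$) is a finite sequence of letters, $|w|=m$ is its length and $1$ denotes the empty word. Let $\mathcal F=\mathbb R\langle\langle A\rangle\rangle$ be the space of formal series $\sum_w c_w w$ over all words with the concatenation product, and let $\mathcal F'=\mathbb R\langle A\rangle$ be the space of finite linear combinations of words, paired with $\mathcal F$ by $\langle \sum_w c_w w,\sum_w d_w w\rangle=\sum_w c_wd_w$. An event is a pair $(\lambda,a)$ with $\lambda>0$ real and $a\in A$; a stream is a finite sequence of events $\sigma=(\lambda_i,a_i)_{i=1}^L$ with $L\ge1$. Let the event map be either $$\text{(E)}\quad p(\lambda,a)=\exp(\lambda a)=\sum_{k\ge0}\frac{\lambda^k}{k!}\,a^k \qquad\text{or}\qquad \text{(I)}\quad p(\lambda,a)=1+\lambda a ,$$ and let $\Phi(\sigma)=p(\lambda_1,a_1)\,p(\lambda_2,a_2)\cdots p(\lambda_L,a_L)\in\mathcal F$. For $\boldsymbol i=(i_1,\dots,i_m)\in\{1,\dots,L\}^m$ write $\lambda(\boldsymbol i)=\lambda_{i_1}\cdots\lambda_{i_m}$, $a(\boldsymbol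 i)=a_{i_1}\cdots a_{i_m}$ and $\boldsymbol i!=\prod_{j=1}^L \#\{t: i_t=j\}!$. Then the following hold for every stream $\sigma$ of length $L$. 1. (Ordered moments.) Let $\Phi_{(m)}(\sigma)$ be the part of $\Phi(\sigma)$ carried by the words of length $m$. In case (E), for all $m\ge0$, $$\Phi_{(m)}(\sigma)=\frac{L^m}{m!}\;\mathbb E\big[\lambda_{i_{(1)}}\cdots\lambda_{i_{(m)}}\;a_{i_{(1)}}\cdots a_{i_{(m)}}\big],$$ where $i_{(1)}\le\dots\le i_{(m)}$ is the order statistic of a sample $(i_1,\dots,i_m)$ drawn uniformly with replacement from $\{1,\dots,L\}$. In case (I), for $0\le m\le L$, $$\Phi_{(m)}(\sigma)=\binom Lm\;\mathbb E\big[\lambda_{i_{(1)}}\cdots\lambda_{i_{(m)}}\;a_{i_{(1)}}\cdots a_{i_{(m)}}\big],$$ where $i_{(1)}<\dots<i_{(m)}$ is the order statistic of a sample drawn uniformly without replacement from $\{1,\dots,L\}$, and $\Phi_{(m)}(\sigma)=0$ for $m>L$. 2. (Coordinates.) For every word $w$ of length $m$, $\langle w,\Phi(\sigma)\rangle=\sum\lambda(\boldsymbol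 i)/\boldsymbol i!$ in case (E), where the sum is over all $\boldsymbol i\in\{1,\dots,L\}^m$ with $i_1\le\cdots\le i_m$ and $a(\boldsymbol i)=w$; and $\langle w,\Phi(\sigma)\rangle=\sum\lambda(\boldsymbol i)$ in case (I), where the sum is over all $\boldsymbol i$ with $i_1<\cdots<i_m$ and $a(\boldsymbol i)=w$. 3. (Hopf algebra.) Let $\operatorname m_p:\mathcal F'\otimes\mathcal F'\to\mathcal F'$ be, in case (E), the shuffle product and, in case (I), the infiltration product. These are the linear maps determined by $\operatorname m_p(1\otimes w)=\operatorname m_p(w\otimes1)=w$ and, for letters $a,b$ and words $v,w$, $$\operatorname m_p(av\otimes bw)=a\operatorname m_p(v\otimes bw)+b\operatorname m_p(av\otimes w)+\theta\,1_{a=b}\;a\operatorname m_p(v\otimes w),$$ with $\theta=0$ for the shuffle product and $\theta=1$ for the infiltration product. Then $\mathcal F'$ with the product $\operatorname m_p$, the deconcatenation coproduct $\Delta_C(w)=\sum_{w=uv}u\otimes v$, the empty word as unit, and the coefficient of the empty word as counit is a commutative Hopf algebra. 4. (Group-likeness.) In case (E), every $\Phi(\sigma)$ is group-like with respect to the shuffle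 product; in case (I), $\Phi(\sigma)$ is group-like with respect to the infiltration product whenever $\lambda_i=1$ for all $i$. Here $f\in\mathcal F$ is called group-like if $\langle 1,f\rangle=1$ and $\Delta f=f\otimes f$ for the coproduct dual to $\operatorname m_p$, i.e. $\langle\operatorname m_p(\ell\otimes\ell'),f\rangle=\langle\ell,f\rangle\langle\ell',f\rangle$ for all $\ell,\ell'\in\mathcal F'$. -/

import Mathlib

open scoped TensorProduct BigOperators

noncomputable section

namespace OrderedMoments

universe u

/-- An event `(λ, a)`: a strictly positive counter increase `λ` and a letter `a`. A stream of
length `L` is a function `Fin L → Event A`. -/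
abbrev Event (A : Type u) : Type u := Set.Ioi (0 : ℝ) × A

/-! ### The feature space of formal power series in non-commuting variables -/

/-- The space `ℝ⟨⟨A⟩⟩` of formal power series `∑ c_w w` over words `w` in the alphabet `A`; a series
is the function `w ↦ c_w`. -/
def FeatureSpace (A : Type u) : Type u := List A → ℝ

namespace FeatureSpace

variable {A : Type u}

instance : AddCommGroup (FeatureSpace A) := inferInstanceAs (AddCommGroup (List A → ℝ))
instance : Module ℝ (FeatureSpace A) := inferInstanceAs (Module ℝ (List A → ℝ))
instance : Module ℚ≥0 (FeatureSpace A) := inferInstanceAs (Module ℚ≥0 (List A → ℝ))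

/-- The concatenation product: the coefficient of `w` in `f * g` is the sum of `f u * g v` over all
factorisations `w = u v`. -/
instance : Mul (FeatureSpace A) :=
  ⟨fun f g w => ∑ k ∈ Finset.range (w.length + 1), f (w.take k) * g (w.drop k)⟩

open Classical in
/-- The series consisting of the single word `w`, with coefficient `1`. -/
def word (w : List A) : FeatureSpace A := fun v => if v = w then 1 else 0

/-- The unit is the empty word. -/
instance : One (FeatureSpace A) := ⟨word []⟩

/-- The series `∑ c_{a v} v` of the coefficients of the words that begin with the letter `a`. -/
def tail (a : A) (f : FeatureSpace A) : FeatureSpace A := fun v => f (a :: v)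

theorem one_apply_nil : (1 : FeatureSpace A) [] = 1 := by
  change word [] [] = 1
  simp [word]

theorem tail_one (a : A) : tail a (1 : FeatureSpace A) = 0 := by
  funext v
  change word [] (a :: v) = 0
  simp [word]

theorem mul_apply (f g : FeatureSpace A) (w : List A) :
    (f * g) w = ∑ k ∈ Finset.range (w.length + 1), f (w.take k) * g (w.drop k) := rfl

theorem mul_nil (f g : FeatureSpace A) : (f * g) [] = f [] * g [] := by
  simp [mul_apply]

theorem mul_cons (f g : FeatureSpace A) (a : A) (w : List A) :
    (f * g) (a :: w) = f [] * g (a :: w) + (tail a f * g) w := by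
  rw [mul_apply, mul_apply, List.length_cons, Finset.sum_range_succ']
  simp [add_comm, tail]

theorem smul_add_mul_apply (c : ℝ) (p q r : FeatureSpace A) (w : List A) :
    ((c • p + q) * r) w = c * (p * r) w + (q * r) w := by
  change ∑ k ∈ Finset.range (w.length + 1), (c * p (w.take k) + q (w.take k)) * r (w.drop k)
    = c * ∑ k ∈ Finset.range (w.length + 1), p (w.take k) * r (w.drop k)
      + ∑ k ∈ Finset.range (w.length + 1), q (w.take k) * r (w.drop k)
  rw [Finset.mul_sum, ← Finset.sum_add_distrib]
  exact Finset.sum_congr rfl fun k _ => by ring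

theorem tail_mul (a : A) (f g : FeatureSpace A) :
    tail a (f * g) = f [] • tail a g + tail a f * g := by
  funext v
  exact mul_cons f g a v

/-- The concatenation product makes the feature space a monoid. -/
instance : Monoid (FeatureSpace A) where
  mul_assoc f g h := by
    funext w
    induction w generalizing f g h with
    | nil => simp only [mul_nil, mul_assoc]
    | cons a w ih =>
      rw [mul_cons, mul_cons f, tail_mul, smul_add_mul_apply, ih, mul_nil, mul_cons g]
      ring
  one_mul f := by
    funext w
    cases w with
    | nil => rw [mul_nil, one_apply_nil, one_mul]
    | cons a w =>
      rw [mul_cons, one_apply_nil, tail_one, mul_apply]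
      simp only [one_mul]
      rw [Finset.sum_eq_zero, add_zero]
      intro k _
      exact zero_mul (f (w.drop k))
  mul_one f := by
    funext w
    induction w generalizing f with
    | nil => rw [mul_nil, one_apply_nil, mul_one]
    | cons a w ih =>
      rw [mul_cons, ih]
      have h : (1 : FeatureSpace A) (a :: w) = 0 := congrFun (tail_one a) w
      rw [h, mul_zero, zero_add]
      rfl

/-- The part of a series that is homogeneous of degree `m`, i.e. carried by words of length `m`. -/
def homogeneousPart (m : ℕ) (f : FeatureSpace A) : FeatureSpace A :=
  fun w => if w.length = m then f w else 0

end FeatureSpace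

open FeatureSpace

variable {A : Type u}

/-! ### Event maps and features -/

open Classical in
/-- The event map `exp (λ a) = ∑ k, λ ^ k / k! • a ^ k`: the coefficient of the word
`a ^ k = a ⋯ a` (`k` letters) is `λ ^ k / k!`, all other coefficients vanish. -/
def expEvent (e : Event A) : FeatureSpace A := fun w =>
  if w = List.replicate w.length e.2 then (e.1 : ℝ) ^ w.length / (w.length.factorial : ℝ) else 0

/-- The event map `1 + λ a`. -/
def linEvent (e : Event A) : FeatureSpace A := 1 + (e.1 : ℝ) • word [e.2]

/-- The feature map `Φ(σ) = p(σ₁) p(σ₂) ⋯ p(σ_L)` with event map `p`. -/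
def feature (p : Event A → FeatureSpace A) {L : ℕ} (σ : Fin L → Event A) : FeatureSpace A :=
  (List.ofFn fun i => p (σ i)).prod

/-- `λ(i) = λ_{i₁} ⋯ λ_{i_m}`. -/
def counterProd {L m : ℕ} (σ : Fin L → Event A) (i : Fin m → Fin L) : ℝ :=
  ∏ t, ((σ (i t)).1 : ℝ)

/-- `a(i) = a_{i₁} ⋯ a_{i_m}`. -/
def letters {L m : ℕ} (σ : Fin L → Event A) (i : Fin m → Fin L) : List A :=
  List.ofFn fun t => (σ (i t)).2

/-- The monomial `λ_{i₁} ⋯ λ_{i_m} a_{i₁} ⋯ a_{i_m}`. -/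
def monomial {L m : ℕ} (σ : Fin L → Event A) (i : Fin m → Fin L) : FeatureSpace A :=
  counterProd σ i • word (letters σ i)

/-- The order statistic of a tuple of indices: the tuple rearranged in non-decreasing order. -/
def orderStatistic {L m : ℕ} (i : Fin m → Fin L) : Fin m → Fin L := i ∘ Tuple.sort i

/-- `i!`, the product over all indices `j` of the factorial of the number of times that `j` occurs
in the tuple `i`. -/
def tupleFactorial {L m : ℕ} (i : Fin m → Fin L) : ℕ :=
  ∏ j : Fin L, (Finset.univ.filter fun t => i t = j).card.factorial

open Classical in
/-- The tuples `i₁ ≤ ⋯ ≤ i_m` with `a_{i₁} ⋯ a_{i_m} = w`, where `m` is the length of `w`. -/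
def weakTuples {L : ℕ} (σ : Fin L → Event A) (w : List A) : Finset (Fin w.length → Fin L) :=
  Finset.univ.filter fun i => Monotone i ∧ letters σ i = w

open Classical in
/-- The tuples `i₁ < ⋯ < i_m` with `a_{i₁} ⋯ a_{i_m} = w`, where `m` is the length of `w`. -/
def strictTuples {L : ℕ} (σ : Fin L → Event A) (w : List A) : Finset (Fin w.length → Fin L) :=
  Finset.univ.filter fun i => StrictMono i ∧ letters σ i = w

/-! ### The dual space of non-commutative polynomials -/

/-- The space `ℝ⟨A⟩` of finite linear combinations of words. -/
abbrev DualSpace (A : Type u) : Type u := List A →₀ ℝ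

/-- A word as an element of the dual space. -/
def dualWord (w : List A) : DualSpace A := Finsupp.single w 1

/-- The pairing `⟨ℓ, f⟩ = ∑ ℓ_w f_w`, as a linear functional of `ℓ`. -/
def pairing (f : FeatureSpace A) : DualSpace A →ₗ[ℝ] ℝ := Finsupp.linearCombination ℝ f

/-- Left multiplication by the letter `a`. -/
def prepend (a : A) : DualSpace A →ₗ[ℝ] DualSpace A := Finsupp.lmapDomain ℝ ℝ (List.cons a)

/-- The shuffle product of two words. -/
def shuffleWord : List A → List A → DualSpace A
  | [], w => dualWord w
  | a :: v, [] => dualWord (a :: v)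
  | a :: v, b :: w => prepend a (shuffleWord v (b :: w)) + prepend b (shuffleWord (a :: v) w)
  termination_by v w => v.length + w.length

open Classical in
/-- The infiltration product of two words. -/
def infiltrationWord : List A → List A → DualSpace A
  | [], w => dualWord w
  | a :: v, [] => dualWord (a :: v)
  | a :: v, b :: w =>
      prepend a (infiltrationWord v (b :: w)) + prepend b (infiltrationWord (a :: v) w)
        + if a = b then prepend a (infiltrationWord v w) else 0
  termination_by v w => v.length + w.length

/-- The bilinear extension of a product of words. -/
def productOfWords (f : List A → List A → DualSpace A) :
    DualSpace A ⊗[ℝ] DualSpace A →ₗ[ℝ] DualSpace A :=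
  TensorProduct.lift
    (Finsupp.linearCombination ℝ fun v => Finsupp.linearCombination ℝ fun w => f v w)

variable (A) in
/-- The shuffle product on `ℝ⟨A⟩`. -/
def shuffleProduct : DualSpace A ⊗[ℝ] DualSpace A →ₗ[ℝ] DualSpace A :=
  productOfWords shuffleWord

variable (A) in
/-- The infiltration product on `ℝ⟨A⟩`. -/
def infiltrationProduct : DualSpace A ⊗[ℝ] DualSpace A →ₗ[ℝ] DualSpace A :=
  productOfWords infiltrationWord

variable (A) in
/-- Deconcatenation, `w ↦ ∑ u ⊗ v` over all factorisations `w = u v`. -/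
def deconcatenation : DualSpace A →ₗ[ℝ] DualSpace A ⊗[ℝ] DualSpace A :=
  Finsupp.linearCombination ℝ fun w =>
    ∑ k ∈ Finset.range (w.length + 1), dualWord (w.take k) ⊗ₜ[ℝ] dualWord (w.drop k)

variable (A) in
/-- The coefficient of the empty word. -/
def constantCoeff : DualSpace A →ₗ[ℝ] ℝ := Finsupp.lapply []

/-- The vector space `V` with product `m`, unit `one`, coproduct `Δ` and counit `ε` is a commutative
Hopf algebra: these maps are the structure maps of a commutative Hopf algebra `H`, carried over along
a linear isomorphism `e`. The antipode is part of the structure of `H`. -/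
def IsCommHopfAlgebra {V : Type u} [AddCommGroup V] [Module ℝ V] (m : V ⊗[ℝ] V →ₗ[ℝ] V) (one : V)
    (Δ : V →ₗ[ℝ] V ⊗[ℝ] V) (ε : V →ₗ[ℝ] ℝ) : Prop :=
  ∃ (H : Type u) (_ : CommRing H) (_ : HopfAlgebra ℝ H) (e : V ≃ₗ[ℝ] H),
    (∀ x y, e (m (x ⊗ₜ[ℝ] y)) = e x * e y) ∧
    e one = 1 ∧
    (∀ x, Coalgebra.comul (R := ℝ) (e x) = TensorProduct.map e.toLinearMap e.toLinearMap (Δ x)) ∧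
    (∀ x, Coalgebra.counit (R := ℝ) (e x) = ε x)

/-- The coproduct on the feature space that is dual to the product `m` on the dual space. Its values
lie in the algebraic dual of `ℝ⟨A⟩ ⊗ ℝ⟨A⟩` (the completed tensor square of `ℝ⟨⟨A⟩⟩`), and
`⟨ℓ ⊗ ℓ', Δ f⟩ = ⟨m (ℓ ⊗ ℓ'), f⟩`. -/
def dualCoproduct (m : DualSpace A ⊗[ℝ] DualSpace A →ₗ[ℝ] DualSpace A) (f : FeatureSpace A) :
    Module.Dual ℝ (DualSpace A ⊗[ℝ] DualSpace A) :=
  pairing f ∘ₗ m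

/-- A series `f` is group-like for the product `m` on the dual space if its constant coefficient is
`1` and `Δ f = f ⊗ f` for the coproduct `Δ` dual to `m`. -/
def IsGroupLikeSeries (m : DualSpace A ⊗[ℝ] DualSpace A →ₗ[ℝ] DualSpace A)
    (f : FeatureSpace A) : Prop :=
  pairing f (dualWord []) = 1 ∧
    dualCoproduct m f =
      TensorProduct.dualDistrib ℝ (DualSpace A) (DualSpace A) (pairing f ⊗ₜ[ℝ] pairing f)

end OrderedMoments

end

noncomputable section

namespace OrderedMoments

open FeatureSpace

universe u

variable {A : Type u}

/-! ### Deleting the first letter -/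

/-- The words of `x` that begin with the letter `c`, with this letter removed. -/
def deleteLetter (c : A) : DualSpace A →ₗ[ℝ] DualSpace A :=
  Finsupp.lcomapDomain (List.cons c) (List.cons_injective)

@[simp] theorem deleteLetter_apply (c : A) (x : DualSpace A) (w : List A) :
    deleteLetter c x w = x (c :: w) := rfl

@[simp] theorem constantCoeff_apply (x : DualSpace A) : constantCoeff A x = x [] := rfl

open Classical in
theorem dualWord_apply (v w : List A) : dualWord v w = if v = w then (1 : ℝ) else 0 :=
  Finsupp.single_apply

theorem prepend_dualWord (a : A) (v : List A) : prepend a (dualWord v) = dualWord (a :: v) := by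
  simp [prepend, dualWord]

@[simp] theorem prepend_apply_nil (a : A) (x : DualSpace A) : prepend a x [] = 0 := by
  refine Finsupp.mapDomain_of_notMem_range x [] ?_
  simp

open Classical in
theorem deleteLetter_prepend (c a : A) (x : DualSpace A) :
    deleteLetter c (prepend a x) = if c = a then x else 0 := by
  ext w
  split_ifs with h
  · subst h
    exact Finsupp.mapDomain_apply List.cons_injective x w
  · refine Finsupp.mapDomain_of_notMem_range x (c :: w) ?_
    rintro ⟨v, hv⟩
    exact h (List.cons.inj hv).1.symm

@[simp] theorem dualWord_nil_apply_nil : dualWord ([] : List A) [] = 1 := by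
  simp [dualWord]

@[simp] theorem deleteLetter_dualWord_nil (c : A) : deleteLetter c (dualWord []) = 0 := by
  ext w
  simp [dualWord_apply]

/-- Linear maps out of the dual space that agree on words are equal. -/
theorem dualSpace_hom_ext {M : Type*} [AddCommMonoid M] [Module ℝ M] {f g : DualSpace A →ₗ[ℝ] M}
    (h : ∀ w, f (dualWord w) = g (dualWord w)) : f = g :=
  Finsupp.lhom_ext' fun w => LinearMap.ext_ring (h w)

/-! ### The quasi-shuffle product with parameter `θ` -/

open Classical in
/-- The product of two words that interpolates between the shuffle product `θ = 0` and the
infiltration product `θ = 1`. -/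
def quasiShuffleWord (θ : ℝ) : List A → List A → DualSpace A
  | [], w => dualWord w
  | a :: v, [] => dualWord (a :: v)
  | a :: v, b :: w =>
      prepend a (quasiShuffleWord θ v (b :: w)) + prepend b (quasiShuffleWord θ (a :: v) w)
        + if a = b then θ • prepend a (quasiShuffleWord θ v w) else 0
  termination_by v w => v.length + w.length

theorem shuffleWord_eq (v w : List A) : shuffleWord v w = quasiShuffleWord 0 v w := by
  induction v, w using shuffleWord.induct with
  | case1 w => simp [shuffleWord, quasiShuffleWord]
  | case2 a v => simp [shuffleWord, quasiShuffleWord]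
  | case3 a v b w h1 h2 => simp [shuffleWord, quasiShuffleWord, h1, h2]

theorem infiltrationWord_eq (v w : List A) : infiltrationWord v w = quasiShuffleWord 1 v w := by
  induction v, w using quasiShuffleWord.induct with
  | case1 w => simp [infiltrationWord, quasiShuffleWord]
  | case2 a v => simp [infiltrationWord, quasiShuffleWord]
  | case3 a v b w h1 h2 h3 => simp [infiltrationWord, quasiShuffleWord, h1, h2, h3]

/-- The bilinear extension of `quasiShuffleWord`. -/
def quasiShuffle (θ : ℝ) : DualSpace A →ₗ[ℝ] DualSpace A →ₗ[ℝ] DualSpace A :=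
  Finsupp.linearCombination ℝ fun v => Finsupp.linearCombination ℝ fun w => quasiShuffleWord θ v w

theorem quasiShuffle_dualWord (θ : ℝ) (v w : List A) :
    quasiShuffle θ (dualWord v) (dualWord w) = quasiShuffleWord θ v w := by
  simp [quasiShuffle, dualWord]

theorem shuffleProduct_tmul (x y : DualSpace A) :
    shuffleProduct A (x ⊗ₜ y) = quasiShuffle 0 x y := by
  simp only [shuffleProduct, productOfWords, TensorProduct.lift.tmul, quasiShuffle, shuffleWord_eq]

theorem infiltrationProduct_tmul (x y : DualSpace A) :
    infiltrationProduct A (x ⊗ₜ y) = quasiShuffle 1 x y := by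
  simp only [infiltrationProduct, productOfWords, TensorProduct.lift.tmul, quasiShuffle,
    infiltrationWord_eq]

theorem quasiShuffle_one_left (θ : ℝ) (y : DualSpace A) : quasiShuffle θ (dualWord []) y = y := by
  have : quasiShuffle θ (dualWord ([] : List A)) = LinearMap.id :=
    dualSpace_hom_ext fun w => by simp [quasiShuffle_dualWord, quasiShuffleWord]
  rw [this, LinearMap.id_apply]

theorem quasiShuffle_apply_nil (θ : ℝ) (x y : DualSpace A) :
    quasiShuffle θ x y [] = x [] * y [] := by
  have : (quasiShuffle θ).compr₂ (constantCoeff A) =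
      (LinearMap.mul ℝ ℝ).compl₁₂ (constantCoeff A) (constantCoeff A) :=
    dualSpace_hom_ext fun v => dualSpace_hom_ext fun w => by
      simp only [LinearMap.compr₂_apply, LinearMap.compl₁₂_apply, quasiShuffle_dualWord,
        constantCoeff_apply, LinearMap.mul_apply']
      cases v with
      | nil => simp [quasiShuffleWord]
      | cons a v =>
        cases w with
        | nil => simp [quasiShuffleWord, dualWord_apply]
        | cons b w =>
          rw [quasiShuffleWord]
          split_ifs <;> simp [dualWord_apply]
  exact LinearMap.congr_fun₂ this x y

theorem deleteLetter_quasiShuffle (θ : ℝ) (c : A) (x y : DualSpace A) :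
    deleteLetter c (quasiShuffle θ x y) =
      quasiShuffle θ (deleteLetter c x) y + quasiShuffle θ x (deleteLetter c y)
        + θ • quasiShuffle θ (deleteLetter c x) (deleteLetter c y) := by
  classical
  have : (quasiShuffle θ).compr₂ (deleteLetter c) =
      (quasiShuffle θ).compl₁₂ (deleteLetter c) LinearMap.id
        + (quasiShuffle θ).compl₁₂ LinearMap.id (deleteLetter c)
        + θ • (quasiShuffle θ).compl₁₂ (deleteLetter c) (deleteLetter c) :=
    dualSpace_hom_ext fun v => dualSpace_hom_ext fun w => by
      simp only [LinearMap.compr₂_apply, LinearMap.add_apply, LinearMap.smul_apply,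
        LinearMap.compl₁₂_apply, LinearMap.id_apply]
      cases v with
      | nil => simp [quasiShuffle_one_left]
      | cons a v =>
        cases w with
        | nil =>
          have h (u : List A) :
              quasiShuffle θ (dualWord u) (dualWord []) = dualWord u := by
            rw [quasiShuffle_dualWord]; cases u <;> simp [quasiShuffleWord]
          rw [h, ← prepend_dualWord, deleteLetter_prepend]
          split_ifs <;> simp [h]
        | cons b w =>
          rw [quasiShuffle_dualWord, quasiShuffleWord, ← prepend_dualWord a v,
            ← prepend_dualWord b w, map_add, map_add, apply_ite (deleteLetter c), map_smul]
          simp only [deleteLetter_prepend, map_zero]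
          simp only [prepend_dualWord, ← quasiShuffle_dualWord]
          by_cases h1 : c = a <;> by_cases h2 : c = b
          · subst h1; subst h2; simp
          · subst h1; simp [h2]
          · subst h2; simp [h1, Ne.symm h1]
          · by_cases h3 : a = b <;> simp [h1, h2, h3]
  exact LinearMap.congr_fun₂ this x y

theorem quasiShuffle_comm (θ : ℝ) (x y : DualSpace A) :
    quasiShuffle θ x y = quasiShuffle θ y x := by
  ext w
  induction w generalizing x y with
  | nil => rw [quasiShuffle_apply_nil, quasiShuffle_apply_nil, mul_comm]
  | cons c w ih =>
    rw [← deleteLetter_apply, ← deleteLetter_apply, deleteLetter_quasiShuffle,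
      deleteLetter_quasiShuffle]
    simp only [Finsupp.add_apply, Finsupp.smul_apply, ih y, ih (deleteLetter c y)]
    ring

theorem quasiShuffle_assoc (θ : ℝ) (x y z : DualSpace A) :
    quasiShuffle θ (quasiShuffle θ x y) z = quasiShuffle θ x (quasiShuffle θ y z) := by
  ext w
  induction w generalizing x y z with
  | nil => simp only [quasiShuffle_apply_nil, mul_assoc]
  | cons c w ih =>
    rw [← deleteLetter_apply, ← deleteLetter_apply]
    simp only [deleteLetter_quasiShuffle, map_add, map_smul, LinearMap.add_apply,
      LinearMap.smul_apply, Finsupp.add_apply, Finsupp.smul_apply, ih, smul_eq_mul]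
    ring

/-! ### Deconcatenation -/

theorem deconcatenation_dualWord (w : List A) : deconcatenation A (dualWord w) =
    ∑ k ∈ Finset.range (w.length + 1), dualWord (w.take k) ⊗ₜ[ℝ] dualWord (w.drop k) := by
  simp [deconcatenation, dualWord]

@[simp] theorem deconcatenation_nil :
    deconcatenation A (dualWord []) = dualWord [] ⊗ₜ[ℝ] dualWord [] := by
  simp [deconcatenation_dualWord]

theorem deconcatenation_prepend (a : A) (x : DualSpace A) : deconcatenation A (prepend a x) =
    dualWord [] ⊗ₜ[ℝ] prepend a x + (prepend a).rTensor _ (deconcatenation A x) := by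
  have : deconcatenation A ∘ₗ prepend a =
      TensorProduct.mk ℝ _ _ (dualWord []) ∘ₗ prepend a
        + (prepend a).rTensor _ ∘ₗ deconcatenation A :=
    dualSpace_hom_ext fun w => by
      simp only [LinearMap.comp_apply, LinearMap.add_apply, prepend_dualWord,
        deconcatenation_dualWord, List.length_cons, Finset.sum_range_succ' _ (w.length + 1)]
      simp [prepend_dualWord, add_comm]
  exact LinearMap.congr_fun this x

theorem dualSpace_word_induction {M : Type*} [AddCommMonoid M] [Module ℝ M]
    {f g : DualSpace A →ₗ[ℝ] M} (nil : f (dualWord []) = g (dualWord []))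
    (cons : ∀ a w, f (dualWord w) = g (dualWord w) →
      f (prepend a (dualWord w)) = g (prepend a (dualWord w))) : f = g :=
  dualSpace_hom_ext fun w => by
    induction w with
    | nil => exact nil
    | cons a w ih => rw [← prepend_dualWord]; exact cons a w ih

theorem deconcatenation_coassoc :
    (TensorProduct.assoc ℝ _ _ _).toLinearMap ∘ₗ (deconcatenation A).rTensor _ ∘ₗ deconcatenation A
      = (deconcatenation A).lTensor _ ∘ₗ deconcatenation A := by
  refine dualSpace_word_induction (by simp) fun a w ih => ?_
  simp only [LinearMap.comp_apply, LinearEquiv.coe_coe, deconcatenation_prepend, map_add,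
    LinearMap.rTensor_tmul, LinearMap.lTensor_tmul, deconcatenation_nil,
    TensorProduct.assoc_tmul, TensorProduct.tmul_add] at ih ⊢
  have h1 (t : DualSpace A ⊗[ℝ] DualSpace A) :
      TensorProduct.assoc ℝ _ _ _ ((deconcatenation A).rTensor _ ((prepend a).rTensor _ t)) =
        dualWord [] ⊗ₜ[ℝ] ((prepend a).rTensor _ t) + (prepend a).rTensor _
          (TensorProduct.assoc ℝ _ _ _ ((deconcatenation A).rTensor (DualSpace A) t)) := by
    induction t with
    | zero => simp
    | add s t hs ht => simp only [map_add, hs, ht, TensorProduct.tmul_add]; abel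
    | tmul x y =>
      simp only [LinearMap.rTensor_tmul, deconcatenation_prepend, TensorProduct.add_tmul, map_add,
        TensorProduct.assoc_tmul]
      congr 1
      induction deconcatenation A x with
      | zero => simp
      | add s t hs ht => simp only [map_add, TensorProduct.add_tmul, hs, ht]
      | tmul x y => simp
  have h2 (t : DualSpace A ⊗[ℝ] DualSpace A) :
      (deconcatenation A).lTensor _ ((prepend a).rTensor _ t) =
        (prepend a).rTensor _ ((deconcatenation A).lTensor (DualSpace A) t) := by
    induction t with
    | zero => simp
    | add s t hs ht => simp only [map_add, hs, ht]
    | tmul x y => simp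
  rw [h1, h2, ih, add_assoc]

theorem rTensor_constantCoeff_deconcatenation :
    (constantCoeff A).rTensor _ ∘ₗ deconcatenation A = TensorProduct.mk ℝ _ _ 1 := by
  refine dualSpace_word_induction (by simp) fun a w ih => ?_
  have h : constantCoeff A ∘ₗ prepend a = 0 := by ext; simp
  simp only [LinearMap.comp_apply, deconcatenation_prepend, map_add, LinearMap.rTensor_tmul,
    ← LinearMap.rTensor_comp_apply, h]
  simp

theorem lTensor_constantCoeff_deconcatenation :
    (constantCoeff A).lTensor _ ∘ₗ deconcatenation A = (TensorProduct.mk ℝ _ _).flip 1 := by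
  refine dualSpace_word_induction (by simp) fun a w ih => ?_
  have h (t : DualSpace A ⊗[ℝ] DualSpace A) :
      (constantCoeff A).lTensor _ ((prepend a).rTensor _ t) =
        (prepend a).rTensor _ ((constantCoeff A).lTensor (DualSpace A) t) := by
    induction t with
    | zero => simp
    | add s t hs ht => simp only [map_add, hs, ht]
    | tmul x y => simp
  rw [LinearMap.comp_apply] at ih
  simp only [LinearMap.comp_apply, deconcatenation_prepend, map_add, h, ih]
  simp

theorem rTensor_deleteLetter_deconcatenation (c : A) (x : DualSpace A) :
    (deleteLetter c).rTensor _ (deconcatenation A x) = deconcatenation A (deleteLetter c x) := by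
  classical
  have : (deleteLetter c).rTensor _ ∘ₗ deconcatenation A = deconcatenation A ∘ₗ deleteLetter c := by
    refine dualSpace_word_induction (by simp) fun a w _ => ?_
    have h : deleteLetter c ∘ₗ prepend a = if c = a then LinearMap.id else 0 := by
      refine LinearMap.ext fun x => ?_
      rw [LinearMap.comp_apply, deleteLetter_prepend]
      split_ifs <;> simp
    simp only [LinearMap.comp_apply, deconcatenation_prepend, map_add, LinearMap.rTensor_tmul,
      ← LinearMap.rTensor_comp_apply, h, deleteLetter_prepend]
    split_ifs <;> simp
  exact LinearMap.congr_fun this x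

/-- An element of `ℝ⟨A⟩ ⊗ M` is determined by its coefficients in `M`. -/
theorem tensor_ext_of_coeff {M : Type*} [AddCommGroup M] [Module ℝ M]
    {s t : DualSpace A ⊗[ℝ] M}
    (h : ∀ w, (Finsupp.lapply w : DualSpace A →ₗ[ℝ] ℝ).rTensor M s =
      (Finsupp.lapply w : DualSpace A →ₗ[ℝ] ℝ).rTensor M t) : s = t := by
  classical
  apply (TensorProduct.finsuppScalarLeft ℝ M (List A)).injective
  ext w
  have key (r : DualSpace A ⊗[ℝ] M) : TensorProduct.finsuppScalarLeft ℝ M (List A) r w =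
      TensorProduct.lid ℝ M ((Finsupp.lapply w : DualSpace A →ₗ[ℝ] ℝ).rTensor M r) :=
    TensorProduct.finsuppScalarLeft_apply r w
  rw [key, key, h]

/-! ### The Hopf algebra of the quasi-shuffle product -/

variable (A) in
/-- The space `ℝ⟨A⟩`, to be equipped with the quasi-shuffle product with parameter `θ`. -/
def QuasiShuffleAlgebra (_θ : ℝ) : Type u := DualSpace A

namespace QuasiShuffleAlgebra

variable {θ : ℝ}

instance : AddCommGroup (QuasiShuffleAlgebra A θ) := inferInstanceAs (AddCommGroup (List A →₀ ℝ))
instance : Module ℝ (QuasiShuffleAlgebra A θ) := inferInstanceAs (Module ℝ (List A →₀ ℝ))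

variable (A θ) in
/-- The identification with `ℝ⟨A⟩`. -/
def ofDual : DualSpace A ≃ₗ[ℝ] QuasiShuffleAlgebra A θ := LinearEquiv.refl ℝ (DualSpace A)

instance : Mul (QuasiShuffleAlgebra A θ) := ⟨fun x y => quasiShuffle (A := A) θ x y⟩
instance : One (QuasiShuffleAlgebra A θ) := ⟨ofDual A θ (dualWord [])⟩

theorem ofDual_quasiShuffle (x y : DualSpace A) :
    ofDual A θ (quasiShuffle θ x y) = ofDual A θ x * ofDual A θ y := rfl

theorem ofDual_nil : ofDual A θ (dualWord []) = 1 := rfl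

instance : CommRing (QuasiShuffleAlgebra A θ) where
  __ := (inferInstance : AddCommGroup (QuasiShuffleAlgebra A θ))
  left_distrib x y z := map_add (quasiShuffle (A := A) θ x) y z
  right_distrib x y z := LinearMap.map_add₂ (quasiShuffle (A := A) θ) x y z
  zero_mul x := LinearMap.map_zero₂ (quasiShuffle (A := A) θ) x
  mul_zero x := map_zero (quasiShuffle (A := A) θ x)
  mul_assoc x y z := quasiShuffle_assoc (A := A) θ x y z
  one_mul x := quasiShuffle_one_left (A := A) θ x
  mul_one x := (quasiShuffle_comm (A := A) θ _ _).trans (quasiShuffle_one_left θ x)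
  mul_comm x y := quasiShuffle_comm (A := A) θ x y

instance : Algebra ℝ (QuasiShuffleAlgebra A θ) :=
  Algebra.ofModule (fun r x y => LinearMap.map_smul₂ (quasiShuffle (A := A) θ) r x y)
    (fun r x y => map_smul (quasiShuffle (A := A) θ x) r y)

instance : Coalgebra ℝ (QuasiShuffleAlgebra A θ) where
  comul := deconcatenation A
  counit := constantCoeff A
  coassoc := deconcatenation_coassoc
  rTensor_counit_comp_comul := rTensor_constantCoeff_deconcatenation
  lTensor_counit_comp_comul := lTensor_constantCoeff_deconcatenation

theorem comul_ofDual (x : DualSpace A) : Coalgebra.comul (R := ℝ) (ofDual A θ x) =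
    TensorProduct.map (ofDual A θ).toLinearMap (ofDual A θ).toLinearMap (deconcatenation A x) :=
  (LinearMap.congr_fun (TensorProduct.map_id (R := ℝ) (M := DualSpace A) (N := DualSpace A))
    (deconcatenation A x)).symm

theorem counit_ofDual (x : DualSpace A) :
    Coalgebra.counit (R := ℝ) (ofDual A θ x) = constantCoeff A x := rfl

theorem comul_ofDual_dualWord (w : List A) :
    Coalgebra.comul (R := ℝ) (ofDual A θ (dualWord w)) = ∑ k ∈ Finset.range (w.length + 1),
      ofDual A θ (dualWord (w.take k)) ⊗ₜ[ℝ] ofDual A θ (dualWord (w.drop k)) := by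
  rw [comul_ofDual, deconcatenation_dualWord, map_sum]
  rfl

/-- `deleteLetter` as an endomorphism of the quasi-shuffle algebra. -/
def del (c : A) : QuasiShuffleAlgebra A θ →ₗ[ℝ] QuasiShuffleAlgebra A θ := deleteLetter c

theorem del_mul (c : A) (x y : QuasiShuffleAlgebra A θ) :
    del c (x * y) = del c x * y + x * del c y + θ • (del c x * del c y) :=
  deleteLetter_quasiShuffle θ c x y

theorem rTensor_del_mul (c : A) (s t : QuasiShuffleAlgebra A θ ⊗[ℝ] QuasiShuffleAlgebra A θ) :
    (del c).rTensor _ (s * t) = (del c).rTensor _ s * t + s * (del c).rTensor _ t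
      + θ • ((del c).rTensor _ s * (del c).rTensor _ t) := by
  induction s with
  | zero => simp
  | add s s' hs hs' => simp only [add_mul, map_add, hs, hs', smul_add]; abel
  | tmul x x' =>
    induction t with
    | zero => simp
    | add s s' hs hs' => simp only [mul_add, map_add, hs, hs', smul_add]; abel
    | tmul y y' =>
      simp only [Algebra.TensorProduct.tmul_mul_tmul, LinearMap.rTensor_tmul, del_mul,
        TensorProduct.add_tmul, TensorProduct.smul_tmul']

theorem rTensor_counit_mul (s t : QuasiShuffleAlgebra A θ ⊗[ℝ] QuasiShuffleAlgebra A θ) :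
    (Coalgebra.counit (R := ℝ)).rTensor _ (s * t) =
      (Coalgebra.counit (R := ℝ)).rTensor (QuasiShuffleAlgebra A θ) s *
        (Coalgebra.counit (R := ℝ)).rTensor _ t := by
  induction s with
  | zero => simp
  | add s s' hs hs' => simp only [add_mul, map_add, hs, hs']
  | tmul x x' =>
    induction t with
    | zero => simp
    | add s s' hs hs' => simp only [mul_add, map_add, hs, hs']
    | tmul y y' =>
      simp only [Algebra.TensorProduct.tmul_mul_tmul, LinearMap.rTensor_tmul]
      congr 1
      exact quasiShuffle_apply_nil (A := A) θ x y

/-- The coefficient of the word `w`. -/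
def coeff (w : List A) : QuasiShuffleAlgebra A θ →ₗ[ℝ] ℝ := Finsupp.lapply w

theorem coeff_nil : coeff (A := A) (θ := θ) [] = Coalgebra.counit := rfl

theorem coeff_cons (c : A) (w : List A) : coeff (θ := θ) (c :: w) = coeff w ∘ₗ del c := rfl

theorem tensor_ext {s t : QuasiShuffleAlgebra A θ ⊗[ℝ] QuasiShuffleAlgebra A θ}
    (h : ∀ w, (coeff w).rTensor _ s = (coeff w).rTensor _ t) : s = t :=
  tensor_ext_of_coeff (A := A) h

theorem rTensor_del_comul (c : A) (x : QuasiShuffleAlgebra A θ) :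
    (del c).rTensor _ (Coalgebra.comul (R := ℝ) x) = Coalgebra.comul (R := ℝ) (del c x) :=
  rTensor_deleteLetter_deconcatenation c x

theorem comul_mul (x y : QuasiShuffleAlgebra A θ) :
    Coalgebra.comul (R := ℝ) (x * y) = Coalgebra.comul x * Coalgebra.comul y := by
  refine tensor_ext fun w => ?_
  induction w generalizing x y with
  | nil =>
    rw [coeff_nil, rTensor_counit_mul, Coalgebra.rTensor_counit_comul,
      Coalgebra.rTensor_counit_comul, Coalgebra.rTensor_counit_comul,
      Algebra.TensorProduct.tmul_mul_tmul, one_mul]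
  | cons c w ih =>
    simp only [coeff_cons, LinearMap.rTensor_comp_apply, rTensor_del_mul, rTensor_del_comul,
      del_mul, map_add, map_smul, ih]

instance : Bialgebra ℝ (QuasiShuffleAlgebra A θ) :=
  Bialgebra.mk' ℝ (QuasiShuffleAlgebra A θ) dualWord_nil_apply_nil
    (fun {x y} => quasiShuffle_apply_nil (A := A) θ x y) deconcatenation_nil
    (fun {x y} => comul_mul x y)

/-- The left convolution inverse of the identity on words, by recursion over proper prefixes. -/
def leftAntipodeWord (θ : ℝ) (w : List A) : QuasiShuffleAlgebra A θ :=
  dualWord w [] • 1 - ∑ k : Fin w.length,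
    leftAntipodeWord θ (w.take k) * ofDual A θ (dualWord (w.drop k))
  termination_by w.length
  decreasing_by simp

/-- The right convolution inverse of the identity on words, by recursion over proper suffixes. -/
def rightAntipodeWord (θ : ℝ) (w : List A) : QuasiShuffleAlgebra A θ :=
  dualWord w [] • 1 - ∑ k : Fin w.length,
    ofDual A θ (dualWord (w.take (k + 1))) * rightAntipodeWord θ (w.drop (k + 1))
  termination_by w.length
  decreasing_by simp only [List.length_drop]; omega

/-- The linear map on the quasi-shuffle algebra with given values on words. -/
def lift (f : List A → QuasiShuffleAlgebra A θ) :
    QuasiShuffleAlgebra A θ →ₗ[ℝ] QuasiShuffleAlgebra A θ :=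
  Finsupp.linearCombination ℝ f ∘ₗ (ofDual A θ).symm.toLinearMap

theorem lift_ofDual_dualWord (f : List A → QuasiShuffleAlgebra A θ) (w : List A) :
    lift f (ofDual A θ (dualWord w)) = f w := by
  simp [lift, dualWord]

theorem hom_ext {M : Type*} [AddCommMonoid M] [Module ℝ M]
    {f g : QuasiShuffleAlgebra A θ →ₗ[ℝ] M}
    (h : ∀ w, f (ofDual A θ (dualWord w)) = g (ofDual A θ (dualWord w))) : f = g :=
  dualSpace_hom_ext (A := A) h

open WithConv LinearMap

theorem lift_leftAntipodeWord_convMul_id :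
    toConv (lift (leftAntipodeWord (A := A) θ)) * toConv LinearMap.id = 1 := by
  refine WithConv.ofConv_injective (hom_ext fun w => ?_)
  change (toConv (lift (leftAntipodeWord (A := A) θ)) * toConv LinearMap.id :
      WithConv (QuasiShuffleAlgebra A θ →ₗ[ℝ] QuasiShuffleAlgebra A θ)) _ =
    (1 : WithConv (QuasiShuffleAlgebra A θ →ₗ[ℝ] QuasiShuffleAlgebra A θ)) _
  rw [convMul_apply, convOne_apply, comul_ofDual_dualWord, Finset.sum_range_succ, map_add, map_add,
    counit_ofDual, Algebra.algebraMap_eq_smul_one, constantCoeff_apply]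
  simp only [map_sum, TensorProduct.map_tmul, mul'_apply, id_apply,
    lift_ofDual_dualWord, List.take_length, List.drop_length, ofDual_nil, mul_one]
  conv_lhs => arg 2; rw [leftAntipodeWord]
  rw [Finset.sum_range fun k =>
    leftAntipodeWord θ (w.take k) * ofDual A θ (dualWord (w.drop k)), add_sub_cancel]

theorem id_convMul_lift_rightAntipodeWord :
    toConv LinearMap.id * toConv (lift (rightAntipodeWord (A := A) θ)) = 1 := by
  refine WithConv.ofConv_injective (hom_ext fun w => ?_)
  change (toConv LinearMap.id * toConv (lift (rightAntipodeWord (A := A) θ)) :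
      WithConv (QuasiShuffleAlgebra A θ →ₗ[ℝ] QuasiShuffleAlgebra A θ)) _ =
    (1 : WithConv (QuasiShuffleAlgebra A θ →ₗ[ℝ] QuasiShuffleAlgebra A θ)) _
  rw [convMul_apply, convOne_apply, comul_ofDual_dualWord, Finset.sum_range_succ', map_add, map_add,
    counit_ofDual, Algebra.algebraMap_eq_smul_one, constantCoeff_apply]
  simp only [map_sum, TensorProduct.map_tmul, mul'_apply, id_apply,
    lift_ofDual_dualWord, List.take_zero, List.drop_zero, ofDual_nil, one_mul]
  conv_lhs => arg 2; rw [rightAntipodeWord]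
  rw [Finset.sum_range fun k =>
    ofDual A θ (dualWord (w.take (k + 1))) * rightAntipodeWord θ (w.drop (k + 1)), add_sub_cancel]

instance : HopfAlgebra ℝ (QuasiShuffleAlgebra A θ) :=
  HopfAlgebra.ofConvInverse (lift (leftAntipodeWord θ)) lift_leftAntipodeWord_convMul_id <| by
    rw [left_inv_eq_right_inv lift_leftAntipodeWord_convMul_id id_convMul_lift_rightAntipodeWord]
    exact id_convMul_lift_rightAntipodeWord

end QuasiShuffleAlgebra

open QuasiShuffleAlgebra

theorem isCommHopfAlgebra_quasiShuffle (θ : ℝ)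
    (m : DualSpace A ⊗[ℝ] DualSpace A →ₗ[ℝ] DualSpace A)
    (hm : ∀ x y, m (x ⊗ₜ y) = quasiShuffle θ x y) :
    IsCommHopfAlgebra m (dualWord []) (deconcatenation A) (constantCoeff A) :=
  ⟨QuasiShuffleAlgebra A θ, inferInstance, inferInstance, ofDual A θ,
    fun x y => by rw [hm, ofDual_quasiShuffle], ofDual_nil, comul_ofDual, counit_ofDual⟩

/-! ### Coordinates of products of weighted events -/

/-- The tuple that starts with `k` zeros and continues with the shifted tuple `i`. -/
def prependZeros {L m : ℕ} (k : ℕ) (i : Fin (m - k) → Fin L) : Fin m → Fin (L + 1) := fun t =>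
  if h : (t : ℕ) < k then 0 else (i ⟨t - k, by omega⟩).succ

theorem prependZeros_of_lt {L m k : ℕ} (i : Fin (m - k) → Fin L) {t : Fin m} (h : (t : ℕ) < k) :
    prependZeros k i t = 0 := dif_pos h

theorem prependZeros_of_le {L m k : ℕ} (i : Fin (m - k) → Fin L) {t : Fin m} (h : k ≤ (t : ℕ)) :
    prependZeros k i t = (i ⟨t - k, by omega⟩).succ := dif_neg (by omega)

theorem prependZeros_add {L m k : ℕ} (i : Fin (m - k) → Fin L) (t : Fin (m - k)) :
    prependZeros k i ⟨t + k, by omega⟩ = (i t).succ := by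
  rw [prependZeros_of_le i (by simp)]
  simp

theorem monotone_prependZeros {L m k : ℕ} {i : Fin (m - k) → Fin L} :
    Monotone (prependZeros k i) ↔ Monotone i := by
  constructor
  · intro h s t hst
    have := h (show (⟨s + k, by omega⟩ : Fin m) ≤ ⟨t + k, by omega⟩ from
      Fin.mk_le_mk.2 (by simpa using hst))
    rw [prependZeros_add, prependZeros_add] at this
    exact Fin.succ_le_succ_iff.1 this
  · intro h s t hst
    have hst' : (s : ℕ) ≤ t := hst
    by_cases hs : (s : ℕ) < k
    · rw [prependZeros_of_lt i hs]; exact Fin.zero_le _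
    · rw [prependZeros_of_le i (by omega), prependZeros_of_le i (by omega)]
      exact Fin.succ_le_succ_iff.2 (h (Fin.mk_le_mk.2 (by omega)))

/-- A product over the entries of a tuple with `k` leading zeros. -/
theorem prod_prependZeros {M : Type*} [CommMonoid M] {L m k : ℕ} (hk : k ≤ m)
    (i : Fin (m - k) → Fin L) (f : Fin (L + 1) → M) :
    ∏ t, f (prependZeros k i t) = f 0 ^ k * ∏ t, f (i t).succ := by
  obtain ⟨r, rfl⟩ := Nat.exists_eq_add_of_le hk
  rw [Fin.prod_univ_add]
  congr 1
  · rw [Finset.prod_congr rfl fun t _ => by rw [prependZeros_of_lt i (by simp)]]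
    simp
  · have hr : r = k + r - k := by omega
    refine Fintype.prod_equiv (finCongr hr) _ _ fun t => ?_
    rw [prependZeros_of_le i (by simp)]
    simp only [Fin.val_natAdd, finCongr_apply]
    congr 3
    ext
    simp

theorem letters_prependZeros {L m k : ℕ} (hk : k ≤ m) (σ : Fin (L + 1) → Event A)
    (i : Fin (m - k) → Fin L) : letters σ (prependZeros k i) =
      List.replicate k (σ 0).2 ++ letters (fun j => σ j.succ) i := by
  refine List.ext_getElem (by simp [letters, hk]) fun n h1 h2 => ?_
  simp only [letters, List.getElem_ofFn, List.getElem_append, List.length_replicate,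
    List.getElem_replicate]
  split_ifs with h
  · rw [prependZeros_of_lt i h]
  · rw [prependZeros_of_le i (by simpa using h)]

theorem card_prependZeros_eq {L m k : ℕ} (hk : k ≤ m) (i : Fin (m - k) → Fin L)
    (j : Fin (L + 1)) : (Finset.univ.filter fun t => prependZeros k i t = j).card =
      (if j = 0 then k else 0) + (Finset.univ.filter fun t => (i t).succ = j).card := by
  have := prod_prependZeros hk i fun l => Multiplicative.ofAdd (if l = j then 1 else 0)
  rw [← ofAdd_sum, ← ofAdd_sum, ← ofAdd_nsmul, ← ofAdd_add] at this
  have := Multiplicative.ofAdd.injective this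
  simp only [Finset.card_filter, this, eq_comm (a := (0 : Fin (L + 1)))]
  split_ifs <;> simp

/-- A sum over non-decreasing tuples, split according to the number of leading zeros. -/
theorem sum_monotone_succ {M : Type*} [AddCommMonoid M] {L m : ℕ}
    (F : (Fin m → Fin (L + 1)) → M) :
    ∑ i : Fin m → Fin (L + 1) with Monotone i, F i =
      ∑ k ∈ Finset.range (m + 1), ∑ i : Fin (m - k) → Fin L with Monotone i,
        F (prependZeros k i) := by
  rw [Finset.sum_sigma']
  symm
  refine Finset.sum_nbij (fun x => prependZeros x.1 x.2) ?_ ?_ ?_ fun _ _ => rfl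
  · rintro ⟨k, i⟩ h
    simp only [Finset.mem_sigma, Finset.mem_filter_univ] at h ⊢
    exact monotone_prependZeros.2 h.2
  · have key {k l : ℕ} (hl : l ≤ m) (i : Fin (m - k) → Fin L) (j : Fin (m - l) → Fin L)
        (h : prependZeros k i = prependZeros l j) : l ≤ k := by
      by_contra! hkl
      have := congrFun h ⟨k, by omega⟩
      rw [prependZeros_of_le i le_rfl, prependZeros_of_lt j hkl] at this
      exact Fin.succ_ne_zero _ this
    rintro ⟨k, i⟩ hk ⟨l, j⟩ hl h
    simp only [Finset.coe_sigma, Set.mem_sigma_iff, Finset.coe_range, Set.mem_Iio] at hk hl h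
    obtain rfl := le_antisymm (key (by omega) j i h.symm) (key (by omega) i j h)
    congr 1
    funext t
    have := congrFun h ⟨t + k, by omega⟩
    rw [prependZeros_add, prependZeros_add] at this
    exact Fin.succ_injective _ this
  · intro i hi
    simp only [Finset.coe_filter, Finset.mem_univ, true_and, Set.mem_ofPred_eq] at hi
    classical
    have hex : ∃ k, ∀ t : Fin m, k ≤ (t : ℕ) → i t ≠ 0 := ⟨m, fun t ht => by omega⟩
    have hkm : Nat.find hex ≤ m := Nat.find_min' hex fun t ht => by omega
    have hlt (t : Fin m) (ht : (t : ℕ) < Nat.find hex) : i t = 0 := by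
      have := Nat.find_min hex ht
      push Not at this
      obtain ⟨s, hs, hs0⟩ := this
      exact le_antisymm (hs0 ▸ hi (show t ≤ s from hs)) (Fin.zero_le _)
    set k := Nat.find hex with hkdef
    let i' : Fin (m - k) → Fin L := fun t =>
      (i ⟨t + k, by omega⟩).pred (Nat.find_spec hex _ (by simp [hkdef]))
    have hi' : prependZeros k i' = i := by
      funext t
      by_cases ht : (t : ℕ) < k
      · rw [prependZeros_of_lt _ ht, hlt t ht]
      · rw [prependZeros_of_le _ (by omega), Fin.succ_pred]
        congr 1
        ext
        simp only
        omega
    refine ⟨⟨k, i'⟩, ?_, hi'⟩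
    simp only [Finset.coe_sigma, Set.mem_sigma_iff, Finset.coe_range, Set.mem_Iio,
      Finset.coe_filter, Finset.mem_univ, true_and, Set.mem_ofPred_eq]
    exact ⟨by omega, monotone_prependZeros.1 (hi' ▸ hi)⟩

open Classical in
/-- The event map `∑ k, c k λ ^ k • a ^ k`. -/
def weightedEvent (c : ℕ → ℝ) (e : Event A) : FeatureSpace A := fun w =>
  if w = List.replicate w.length e.2 then c w.length * (e.1 : ℝ) ^ w.length else 0

/-- The product over all indices of the weight of their multiplicity in the tuple `i`. -/
def tupleWeight (c : ℕ → ℝ) {L m : ℕ} (i : Fin m → Fin L) : ℝ :=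
  ∏ j : Fin L, c (Finset.univ.filter fun t => i t = j).card

theorem feature_succ (p : Event A → FeatureSpace A) {L : ℕ} (σ : Fin (L + 1) → Event A) :
    feature p σ = p (σ 0) * feature p fun j => σ j.succ := by
  simp [feature, List.ofFn_succ]

open Classical in
theorem feature_weightedEvent_apply (c : ℕ → ℝ) {L m : ℕ} (σ : Fin L → Event A)
    (w : List A) (hw : w.length = m) : feature (weightedEvent c) σ w =
      ∑ i : Fin m → Fin L with Monotone i,
        if letters σ i = w then counterProd σ i * tupleWeight c i else 0 := by
  induction L generalizing m w with
  | zero =>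
    have hf : feature (weightedEvent c) σ = 1 := by simp [feature]
    rw [hf]
    cases w with
    | nil =>
      subst hw
      rw [one_apply_nil, Finset.filter_true_of_mem fun i _ s => s.elim0]
      simp [letters, counterProd, tupleWeight]
    | cons a w =>
      subst hw
      rw [Finset.sum_eq_zero fun i _ => (i 0).elim0]
      exact congrFun (tail_one a) w
  | succ L ih =>
    rw [feature_succ, mul_apply, hw, sum_monotone_succ]
    refine Finset.sum_congr rfl fun k hk => ?_
    have hk : k ≤ m := by simpa [Nat.lt_succ_iff] using hk
    rw [ih _ (w.drop k) (by simp [hw] : _ = m - k), Finset.mul_sum]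
    refine Finset.sum_congr rfl fun i _ => ?_
    have hwt : tupleWeight c (prependZeros k i) = c k * tupleWeight c i := by
      simp only [tupleWeight, Fin.prod_univ_succ, card_prependZeros_eq hk]
      simp
    have hcp : counterProd σ (prependZeros k i) =
        ((σ 0).1 : ℝ) ^ k * counterProd (fun j => σ j.succ) i :=
      prod_prependZeros hk i fun j => ((σ j).1 : ℝ)
    have hlen : (w.take k).length = k := by simp [hw, hk]
    have hlet : letters σ (prependZeros k i) = w ↔
        w.take k = List.replicate k (σ 0).2 ∧ letters (fun j => σ j.succ) i = w.drop k := by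
      rw [letters_prependZeros hk]
      constructor
      · rintro rfl
        simp
      · rintro ⟨h1, h2⟩
        rw [← h1, h2, List.take_append_drop]
    rw [weightedEvent, hlen, hwt, hcp]
    by_cases h1 : w.take k = List.replicate k (σ 0).2 <;>
      by_cases h2 : letters (fun j => σ j.succ) i = w.drop k <;> simp [hlet, h1, h2]
    ring

theorem pairing_dualWord (f : FeatureSpace A) (w : List A) : pairing f (dualWord w) = f w :=
  (Finsupp.linearCombination_single ℝ (1 : ℝ) w).trans (one_smul ℝ (f w))

theorem expEvent_eq_weightedEvent :
    (expEvent : Event A → FeatureSpace A) = weightedEvent fun k => (k.factorial : ℝ)⁻¹ := by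
  funext e w
  simp only [expEvent, weightedEvent]
  split_ifs
  · rw [div_eq_inv_mul]
  · rfl

theorem linEvent_eq_weightedEvent :
    (linEvent : Event A → FeatureSpace A) = weightedEvent fun k => if k ≤ 1 then 1 else 0 := by
  classical
  funext e w
  change (if w = [] then (1 : ℝ) else 0) + (e.1 : ℝ) * (if w = [e.2] then (1 : ℝ) else 0) = _
  rw [weightedEvent]
  match w with
  | [] => simp
  | [a] => simp
  | a :: b :: w => simp

theorem tupleWeight_inv_factorial {L m : ℕ} (i : Fin m → Fin L) :
    tupleWeight (fun k => (k.factorial : ℝ)⁻¹) i = (tupleFactorial i : ℝ)⁻¹ := by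
  simp [tupleWeight, tupleFactorial]

theorem card_fiber_le_one_iff {L m : ℕ} (i : Fin m → Fin L) :
    (∀ j, (Finset.univ.filter fun t => i t = j).card ≤ 1) ↔ Function.Injective i := by
  simp only [Finset.card_le_one, Finset.mem_filter_univ]
  exact ⟨fun h s t hst => h _ s hst t rfl, fun h j s hs t ht => h (hs.trans ht.symm)⟩

open Classical in
theorem tupleWeight_indicator {L m : ℕ} (i : Fin m → Fin L) :
    tupleWeight (fun k => if k ≤ 1 then 1 else 0) i = if Function.Injective i then 1 else 0 := by
  rw [tupleWeight, Finset.prod_ite_zero]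
  simp [card_fiber_le_one_iff]

theorem tupleFactorial_eq_one {L m : ℕ} {i : Fin m → Fin L} (hi : Function.Injective i) :
    tupleFactorial i = 1 :=
  Finset.prod_eq_one fun j _ =>
    Nat.factorial_eq_one.2 ((card_fiber_le_one_iff i).2 hi j)

/-! ### Ordered moments -/

open Classical in
/-- Each tuple is the rearrangement of its order statistic in `i!` ways. -/
theorem card_rearrangements {L m : ℕ} (i : Fin m → Fin L) :
    (Finset.univ.filter fun π : Equiv.Perm (Fin m) => orderStatistic i ∘ π = i).card =
      tupleFactorial i := by
  have h := DomMulAct.stabilizer_card i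
  rw [Fintype.card_subtype] at h
  calc _ = (Finset.univ.filter fun π : Equiv.Perm (Fin m) => i ∘ π = i).card := by
        refine Finset.card_equiv (Equiv.mulLeft (Tuple.sort i)) fun π => ?_
        rw [Finset.mem_filter_univ, Finset.mem_filter_univ]
        rfl
    _ = _ := by
        rw [h, tupleFactorial]
        exact Finset.prod_congr rfl fun j _ => by rw [Fintype.card_subtype]

theorem orderStatistic_comp_perm {L m : ℕ} {s : Fin m → Fin L} (hs : Monotone s)
    (π : Equiv.Perm (Fin m)) : orderStatistic (s ∘ π) = s :=
  (Tuple.comp_perm_comp_sort_eq_comp_sort (f := s) (σ := π)).trans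
    (by rw [(Tuple.sort_eq_refl_iff_monotone (f := s)).2 hs]; rfl)

theorem tupleFactorial_comp_perm {L m : ℕ} (s : Fin m → Fin L) (π : Equiv.Perm (Fin m)) :
    tupleFactorial (s ∘ π) = tupleFactorial s := by
  refine Finset.prod_congr rfl fun j _ => ?_
  congr 1
  exact Finset.card_equiv π fun t => by simp

theorem tupleFactorial_ne_zero {L m : ℕ} (i : Fin m → Fin L) : (tupleFactorial i : ℝ) ≠ 0 := by
  simp [tupleFactorial, Finset.prod_ne_zero_iff, Nat.factorial_ne_zero]

/-- A sum over order statistics of all tuples, as a weighted sum over non-decreasing tuples. -/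
theorem sum_orderStatistic {L m : ℕ} (g : (Fin m → Fin L) → ℝ) :
    ∑ i, g (orderStatistic i) =
      m.factorial * ∑ i : Fin m → Fin L with Monotone i, g i / tupleFactorial i := by
  classical
  have hfiber (i : Fin m → Fin L) : g (orderStatistic i) =
      ∑ s : Fin m → Fin L with Monotone s, ∑ π : Equiv.Perm (Fin m),
        if s ∘ π = i then g s / tupleFactorial s else 0 := by
    rw [Finset.sum_eq_single (orderStatistic i)]
    · rw [← Finset.sum_filter, Finset.sum_const, card_rearrangements, nsmul_eq_mul,
        orderStatistic, tupleFactorial_comp_perm, mul_div_cancel₀ _ (tupleFactorial_ne_zero i)]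
    · intro s hs hne
      refine Finset.sum_eq_zero fun π _ => if_neg ?_
      rintro rfl
      exact hne (orderStatistic_comp_perm (by simpa using hs) π).symm
    · intro h
      simp [orderStatistic, Tuple.monotone_sort] at h
  simp_rw [hfiber]
  rw [Finset.sum_comm, Finset.mul_sum]
  refine Finset.sum_congr rfl fun s _ => ?_
  rw [Finset.sum_comm]
  simp [Fintype.card_perm]

/-! ### Group-like series -/

/-- The functional of the series `f` is a character of the quasi-shuffle algebra. -/
def IsCharacter (θ : ℝ) (f : FeatureSpace A) : Prop :=
  f [] = 1 ∧ ∀ x y, pairing f (quasiShuffle θ x y) = pairing f x * pairing f y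

theorem IsCharacter.isGroupLikeSeries {θ : ℝ} {f : FeatureSpace A} (hf : IsCharacter θ f)
    {m : DualSpace A ⊗[ℝ] DualSpace A →ₗ[ℝ] DualSpace A}
    (hm : ∀ x y, m (x ⊗ₜ y) = quasiShuffle θ x y) : IsGroupLikeSeries m f := by
  refine ⟨(pairing_dualWord f []).trans hf.1, TensorProduct.ext' fun x y => ?_⟩
  rw [dualCoproduct, LinearMap.comp_apply, hm, hf.2, TensorProduct.dualDistrib_apply]

/-- A character as an algebra homomorphism. -/
def IsCharacter.toAlgHom {θ : ℝ} {f : FeatureSpace A} (hf : IsCharacter θ f) :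
    QuasiShuffleAlgebra A θ →ₐ[ℝ] ℝ :=
  AlgHom.ofLinearMap (pairing f ∘ₗ (QuasiShuffleAlgebra.ofDual A θ).symm.toLinearMap)
    ((pairing_dualWord f []).trans hf.1) hf.2

theorem pairing_one : pairing (1 : FeatureSpace A) = constantCoeff A := by
  classical
  refine dualSpace_hom_ext fun w => ?_
  rw [pairing_dualWord, constantCoeff_apply, dualWord_apply]
  change (if w = [] then (1 : ℝ) else 0) = _
  rfl

theorem isCharacter_one (θ : ℝ) : IsCharacter θ (1 : FeatureSpace A) :=
  ⟨one_apply_nil, fun x y => by simpa [pairing_one] using quasiShuffle_apply_nil θ x y⟩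

theorem IsCharacter.mul {θ : ℝ} {f g : FeatureSpace A} (hf : IsCharacter θ f)
    (hg : IsCharacter θ g) : IsCharacter θ (f * g) := by
  let χ : QuasiShuffleAlgebra A θ →ₐ[ℝ] ℝ :=
    (Algebra.TensorProduct.lift hf.toAlgHom hg.toAlgHom fun _ _ => Commute.all _ _).comp
      (Bialgebra.comulAlgHom ℝ _)
  have h : pairing (f * g) = χ.toLinearMap ∘ₗ (QuasiShuffleAlgebra.ofDual A θ).toLinearMap := by
    refine dualSpace_hom_ext fun w => ?_
    rw [pairing_dualWord, mul_apply]
    change _ = Algebra.TensorProduct.lift hf.toAlgHom hg.toAlgHom (fun _ _ => Commute.all _ _)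
      (Coalgebra.comul (R := ℝ) (QuasiShuffleAlgebra.ofDual A θ (dualWord w)))
    rw [QuasiShuffleAlgebra.comul_ofDual_dualWord, map_sum]
    refine Finset.sum_congr rfl fun k _ => ?_
    rw [Algebra.TensorProduct.lift_tmul, ← pairing_dualWord f, ← pairing_dualWord g]
    rfl
  refine ⟨by rw [mul_nil, hf.1, hg.1, mul_one], fun x y => ?_⟩
  rw [h]
  exact map_mul χ (QuasiShuffleAlgebra.ofDual A θ x) (QuasiShuffleAlgebra.ofDual A θ y)

theorem isCharacter_feature {θ : ℝ} {p : Event A → FeatureSpace A} {L : ℕ} (σ : Fin L → Event A)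
    (hp : ∀ i, IsCharacter θ (p (σ i))) : IsCharacter θ (feature p σ) := by
  induction L with
  | zero => simpa [feature] using isCharacter_one θ
  | succ L ih => rw [feature_succ]; exact (hp 0).mul (ih _ fun i => hp i.succ)

theorem isCharacter_linEvent {e : Event A} (he : (e.1 : ℝ) = 1) : IsCharacter 1 (linEvent e) := by
  classical
  have h : pairing (linEvent e) = constantCoeff A + constantCoeff A ∘ₗ deleteLetter e.2 := by
    refine dualSpace_hom_ext fun w => ?_
    rw [pairing_dualWord, LinearMap.add_apply, LinearMap.comp_apply, constantCoeff_apply,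
      constantCoeff_apply, deleteLetter_apply, dualWord_apply, dualWord_apply]
    change (if w = [] then (1 : ℝ) else 0) + (e.1 : ℝ) * (if w = [e.2] then (1 : ℝ) else 0) = _
    rw [he, one_mul]
  refine ⟨?_, fun x y => ?_⟩
  · rw [← pairing_dualWord (linEvent e), h]
    simp [dualWord_apply]
  · have hd := congrArg (constantCoeff A) (deleteLetter_quasiShuffle 1 e.2 x y)
    simp only [constantCoeff_apply, Finsupp.add_apply, Finsupp.smul_apply,
      quasiShuffle_apply_nil, deleteLetter_apply, smul_eq_mul] at hd
    simp only [h, LinearMap.add_apply, LinearMap.comp_apply, constantCoeff_apply,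
      quasiShuffle_apply_nil, deleteLetter_apply, hd]
    ring

/-! The series `exp (λ a)` is a character because the words `a ^ n` have divided powers of `λ` as
coefficients: these are the values of a homomorphism to polynomials in `λ`. -/

open Polynomial Classical in
/-- The linear map that sends `a ^ n` to `X ^ n / n!` and all other words to `0`. -/
def dividedPowerMap (a : A) : DualSpace A →ₗ[ℝ] ℝ[X] :=
  Finsupp.linearCombination ℝ fun w =>
    if w = List.replicate w.length a then Polynomial.monomial w.length (w.length.factorial : ℝ)⁻¹
    else 0

open Classical in
theorem dividedPowerMap_dualWord (a : A) (w : List A) : dividedPowerMap a (dualWord w) =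
    if w = List.replicate w.length a then Polynomial.monomial w.length (w.length.factorial : ℝ)⁻¹
    else 0 := by
  simp [dividedPowerMap, dualWord]

theorem derivative_dividedPowerMap (a : A) (x : DualSpace A) :
    Polynomial.derivative (dividedPowerMap a x) = dividedPowerMap a (deleteLetter a x) := by
  classical
  have : Polynomial.derivative ∘ₗ dividedPowerMap a = dividedPowerMap a ∘ₗ deleteLetter a := by
    refine dualSpace_hom_ext fun w => ?_
    rw [LinearMap.comp_apply, LinearMap.comp_apply]
    cases w with
    | nil => simp [dividedPowerMap_dualWord]
    | cons b w =>
      have hf : ((w.length + 1).factorial : ℝ)⁻¹ * (w.length + 1 : ℝ) =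
          (w.length.factorial : ℝ)⁻¹ := by
        have := Nat.cast_add_one_ne_zero (R := ℝ) w.length
        rw [Nat.factorial_succ]
        push_cast
        field_simp
      rw [dividedPowerMap_dualWord, ← prepend_dualWord, deleteLetter_prepend,
        apply_ite (dividedPowerMap a), dividedPowerMap_dualWord, map_zero]
      simp only [List.length_cons, List.replicate_succ, List.cons.injEq]
      by_cases h1 : a = b
      · subst h1
        by_cases h2 : w = List.replicate w.length a
        · rw [if_pos ⟨rfl, h2⟩, if_pos rfl, if_pos h2, Polynomial.derivative_monomial]
          push_cast
          rw [hf]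
        · rw [if_neg fun h => h2 h.2, if_pos rfl, if_neg h2, map_zero]
      · rw [if_neg fun h => h1 h.1.symm, if_neg h1, map_zero]
  exact LinearMap.congr_fun this x

theorem dividedPowerMap_coeff_zero (a : A) (x : DualSpace A) :
    (dividedPowerMap a x).coeff 0 = x [] := by
  classical
  have : Polynomial.lcoeff ℝ 0 ∘ₗ dividedPowerMap a = constantCoeff A := by
    refine dualSpace_hom_ext fun w => ?_
    rw [LinearMap.comp_apply, constantCoeff_apply, dividedPowerMap_dualWord, dualWord_apply,
      Polynomial.lcoeff_apply]
    cases w with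
    | nil => simp
    | cons b w => split_ifs <;> simp_all [Polynomial.coeff_monomial]
  exact LinearMap.congr_fun this x

theorem dividedPowerMap_quasiShuffle (a : A) (x y : DualSpace A) :
    dividedPowerMap a (quasiShuffle 0 x y) = dividedPowerMap a x * dividedPowerMap a y := by
  ext n
  induction n generalizing x y with
  | zero =>
    rw [Polynomial.mul_coeff_zero, dividedPowerMap_coeff_zero, dividedPowerMap_coeff_zero,
      dividedPowerMap_coeff_zero, quasiShuffle_apply_nil]
  | succ n ih =>
    refine mul_right_cancel₀ (Nat.cast_add_one_ne_zero (R := ℝ) n) ?_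
    rw [← Polynomial.coeff_derivative, ← Polynomial.coeff_derivative, derivative_dividedPowerMap,
      Polynomial.derivative_mul, derivative_dividedPowerMap, derivative_dividedPowerMap,
      deleteLetter_quasiShuffle, zero_smul, add_zero, map_add, Polynomial.coeff_add,
      Polynomial.coeff_add, ih, ih]

theorem isCharacter_expEvent (e : Event A) : IsCharacter 0 (expEvent e) := by
  classical
  have h (x : DualSpace A) : pairing (expEvent e) x = (dividedPowerMap e.2 x).eval (e.1 : ℝ) := by
    have : pairing (expEvent e) = Polynomial.leval (e.1 : ℝ) ∘ₗ dividedPowerMap e.2 := by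
      refine dualSpace_hom_ext fun w => ?_
      rw [pairing_dualWord, LinearMap.comp_apply, dividedPowerMap_dualWord, expEvent,
        Polynomial.leval_apply]
      split_ifs
      · rw [Polynomial.eval_monomial, div_eq_inv_mul]
      · simp
    rw [this]
    rfl
  refine ⟨by simp [expEvent], fun x y => ?_⟩
  rw [h, h, h, dividedPowerMap_quasiShuffle, Polynomial.eval_mul]

theorem expect_apply {ι : Type*} [Fintype ι] (F : ι → FeatureSpace A) (w : List A) :
    (𝔼 i, F i) w = (Fintype.card ι : ℝ)⁻¹ * ∑ i, F i w := by
  let eval : FeatureSpace A →+ ℝ := ⟨⟨fun f => f w, rfl⟩, fun _ _ => rfl⟩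
  have hs : (∑ i, F i) w = ∑ i, F i w := map_sum eval F Finset.univ
  rw [Finset.expect, ← hs]
  change ((Finset.univ : Finset ι).card : ℚ≥0)⁻¹ • ((∑ i, F i) w) = _
  rw [NNRat.smul_def]
  simp

open Classical in
theorem monomial_apply {L m : ℕ} (σ : Fin L → Event A) (i : Fin m → Fin L) (w : List A) :
    monomial σ i w = if letters σ i = w then counterProd σ i else 0 := by
  change counterProd σ i * (if w = letters σ i then (1 : ℝ) else 0) = _
  rw [mul_ite, mul_one, mul_zero]
  exact if_congr eq_comm rfl rfl

theorem monomial_apply_of_length_ne {L m : ℕ} (σ : Fin L → Event A) (i : Fin m → Fin L)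
    {w : List A} (hw : w.length ≠ m) : monomial σ i w = 0 := by
  classical
  rw [monomial_apply, if_neg]
  rintro rfl
  simp [letters] at hw

theorem feature_expEvent_apply {L m : ℕ} (σ : Fin L → Event A) (w : List A) (hw : w.length = m) :
    feature expEvent σ w =
      ∑ i : Fin m → Fin L with Monotone i, monomial σ i w / tupleFactorial i := by
  rw [expEvent_eq_weightedEvent, feature_weightedEvent_apply _ σ w hw]
  refine Finset.sum_congr rfl fun i _ => ?_
  rw [monomial_apply, tupleWeight_inv_factorial, ite_div, zero_div, div_eq_mul_inv]

open Classical in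
theorem feature_linEvent_apply {L m : ℕ} (σ : Fin L → Event A) (w : List A) (hw : w.length = m) :
    feature linEvent σ w =
      ∑ i : Fin m → Fin L with Monotone i, if Function.Injective i then monomial σ i w else 0 := by
  rw [linEvent_eq_weightedEvent, feature_weightedEvent_apply _ σ w hw]
  refine Finset.sum_congr rfl fun i _ => ?_
  rw [monomial_apply, tupleWeight_indicator]
  split_ifs <;> simp

theorem homogeneousPart_feature_expEvent {L : ℕ} (hL : 1 ≤ L) (σ : Fin L → Event A) (m : ℕ) :
    homogeneousPart m (feature expEvent σ) =
      ((L : ℝ) ^ m / (m.factorial : ℝ)) • 𝔼 i : Fin m → Fin L, monomial σ (orderStatistic i) := by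
  funext w
  change (if w.length = m then _ else 0) =
    (L : ℝ) ^ m / (m.factorial : ℝ) * (𝔼 i : Fin m → Fin L, monomial σ (orderStatistic i)) w
  rw [expect_apply]
  split_ifs with hw
  · rw [feature_expEvent_apply σ w hw, sum_orderStatistic fun i => monomial σ i w]
    have h1 : (L : ℝ) ≠ 0 := by positivity
    have h2 : (m.factorial : ℝ) ≠ 0 := by positivity
    simp only [Fintype.card_fun, Fintype.card_fin, Nat.cast_pow]
    field_simp
  · simp [monomial_apply_of_length_ne σ _ hw]

theorem pairing_feature_expEvent {L : ℕ} (σ : Fin L → Event A) (w : List A) :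
    pairing (feature expEvent σ) (dualWord w) =
      ∑ i ∈ weakTuples σ w, counterProd σ i / (tupleFactorial i : ℝ) := by
  classical
  rw [pairing_dualWord, feature_expEvent_apply σ w rfl, weakTuples, Finset.sum_filter,
    Finset.sum_filter]
  refine Finset.sum_congr rfl fun i _ => ?_
  rw [monomial_apply]
  by_cases h1 : Monotone i <;> by_cases h2 : letters σ i = w <;> simp [h1, h2]

open Classical in
theorem sum_embedding_orderStatistic {L m : ℕ} (g : (Fin m → Fin L) → ℝ) :
    ∑ i : Fin m ↪ Fin L, g (orderStatistic i) =
      m.factorial * ∑ i : Fin m → Fin L with Monotone i,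
        if Function.Injective i then g i else 0 := by
  have h : ∑ i : Fin m ↪ Fin L, g (orderStatistic i) =
      ∑ i : Fin m → Fin L,
        if Function.Injective (orderStatistic i) then g (orderStatistic i) else 0 := by
    have hinj (i : Fin m → Fin L) :
        Function.Injective (orderStatistic i) ↔ Function.Injective i :=
      (Tuple.sort i).injective_comp i
    simp only [hinj]
    rw [← Finset.sum_filter]
    refine Finset.sum_bij (fun i _ => i) (fun i _ => by simpa using i.injective)
      (fun i _ j _ h => DFunLike.coe_injective h)
      (fun i hi => ⟨⟨i, by simpa using hi⟩, Finset.mem_univ _, rfl⟩) fun _ _ => rfl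
  rw [h, sum_orderStatistic fun i => if Function.Injective i then g i else 0]
  congr 1
  refine Finset.sum_congr rfl fun i _ => ?_
  split_ifs with hi
  · rw [tupleFactorial_eq_one hi, Nat.cast_one, div_one]
  · rw [zero_div]

theorem homogeneousPart_feature_linEvent {L m : ℕ} (hm : m ≤ L) (σ : Fin L → Event A) :
    homogeneousPart m (feature linEvent σ) =
      (L.choose m : ℝ) • 𝔼 i : Fin m ↪ Fin L, monomial σ (orderStatistic i) := by
  classical
  funext w
  change (if w.length = m then _ else 0) =
    (L.choose m : ℝ) * (𝔼 i : Fin m ↪ Fin L, monomial σ (orderStatistic i)) w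
  rw [expect_apply]
  split_ifs with hw
  · rw [feature_linEvent_apply σ w hw, sum_embedding_orderStatistic fun i => monomial σ i w]
    have h1 : (m.factorial : ℝ) ≠ 0 := by positivity
    have h2 : (L.choose m : ℝ) ≠ 0 := by exact_mod_cast (Nat.choose_pos hm).ne'
    rw [Fintype.card_embedding_eq, Fintype.card_fin, Fintype.card_fin,
      Nat.descFactorial_eq_factorial_mul_choose]
    push_cast
    field_simp
  · simp [monomial_apply_of_length_ne σ _ hw]

theorem homogeneousPart_feature_linEvent_of_lt {L m : ℕ} (hm : L < m) (σ : Fin L → Event A) :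
    homogeneousPart m (feature linEvent σ) = 0 := by
  classical
  funext w
  change (if w.length = m then _ else 0) = (0 : ℝ)
  split_ifs with hw
  · rw [feature_linEvent_apply σ w hw]
    refine Finset.sum_eq_zero fun i _ => if_neg fun hi => ?_
    have := Fintype.card_le_of_injective i hi
    simp only [Fintype.card_fin] at this
    omega
  · rfl

theorem pairing_feature_linEvent {L : ℕ} (σ : Fin L → Event A) (w : List A) :
    pairing (feature linEvent σ) (dualWord w) = ∑ i ∈ strictTuples σ w, counterProd σ i := by
  classical
  rw [pairing_dualWord, feature_linEvent_apply σ w rfl, strictTuples, Finset.sum_filter,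
    Finset.sum_filter]
  refine Finset.sum_congr rfl fun i _ => ?_
  have hi : StrictMono i ↔ Monotone i ∧ Function.Injective i :=
    ⟨fun h => ⟨h.monotone, h.injective⟩, fun h => h.1.strictMono_of_injective h.2⟩
  rw [monomial_apply]
  by_cases h1 : Monotone i <;> by_cases h2 : Function.Injective i <;> simp [hi, h1, h2]

end OrderedMoments

end

open OrderedMoments FeatureSpace in
theorem theoremB1 {A : Type*} [Finite A] :
    -- the event map `exp (λ a)` and the shuffle product
    ((∀ (L : ℕ), 1 ≤ L → ∀ σ : Fin L → Event A,
        (∀ m : ℕ, homogeneousPart m (feature expEvent σ) =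
          ((L : ℝ) ^ m / (m.factorial : ℝ)) • 𝔼 i : Fin m → Fin L, monomial σ (orderStatistic i)) ∧
        (∀ w : List A, pairing (feature expEvent σ) (dualWord w) =
          ∑ i ∈ weakTuples σ w, counterProd σ i / (tupleFactorial i : ℝ)) ∧
        IsGroupLikeSeries (shuffleProduct A) (feature expEvent σ)) ∧
      IsCommHopfAlgebra (shuffleProduct A) (dualWord []) (deconcatenation A) (constantCoeff A)) ∧
    -- the event map `1 + λ a` and the infiltration product
    ((∀ (L : ℕ), 1 ≤ L → ∀ σ : Fin L → Event A,
        (∀ m : ℕ, m ≤ L → homogeneousPart m (feature linEvent σ) =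
          (L.choose m : ℝ) • 𝔼 i : Fin m ↪ Fin L, monomial σ (orderStatistic i)) ∧
        (∀ m : ℕ, L < m → homogeneousPart m (feature linEvent σ) = 0) ∧
        (∀ w : List A, pairing (feature linEvent σ) (dualWord w) =
          ∑ i ∈ strictTuples σ w, counterProd σ i) ∧
        ((∀ i, ((σ i).1 : ℝ) = 1) →
          IsGroupLikeSeries (infiltrationProduct A) (feature linEvent σ))) ∧
      IsCommHopfAlgebra (infiltrationProduct A) (dualWord []) (deconcatenation A)
        (constantCoeff A)) := by
  exact ⟨⟨fun L hL σ => ⟨homogeneousPart_feature_expEvent hL σ, pairing_feature_expEvent σ,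
      (isCharacter_feature σ fun i => isCharacter_expEvent (σ i)).isGroupLikeSeries
        shuffleProduct_tmul⟩,
      isCommHopfAlgebra_quasiShuffle 0 _ shuffleProduct_tmul⟩,
    ⟨fun L _ σ => ⟨fun m hm => homogeneousPart_feature_linEvent hm σ,
      fun m hm => homogeneousPart_feature_linEvent_of_lt hm σ, pairing_feature_linEvent σ,
      fun hσ => (isCharacter_feature σ fun i => isCharacter_linEvent (hσ i)).isGroupLikeSeries
        infiltrationProduct_tmul⟩,
      isCommHopfAlgebra_quasiShuffle 1 _ infiltrationProduct_tmul⟩⟩
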